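/- For integers $a_1,\dots,a_d\ge 1$ with $a_1\ge2$ and $|z|\le 1$ let $$\operatorname{Li}_{a_1,\ldots,a_d}(z)=\sum_{n_1>\cdots>n_d>0}\frac{z^{n_1}}{n_1^{a_1}\cdots n_d^{a_d}},\qquad \zeta(a_1,\ldots,a_d)=\operatorname{Li}_{a_1,\ldots,a_d}(1),$$ write $\{1\}^b$ for the string $1,\dots,1$ of length $b$, and for integers $n\ge1$ and $0\le k\le n-1$ let $$\operatorname{Ls}_n^{(k)}(\tau)=-\int_0^\tau \theta^k\,\log^{n-1-k}\left|2\sin\tfrac\theta2\right|\,d\theta .$$ With $w=a_1+\cdots+a_d$, let $\operatorname{Cl}_{a_1,\ldots,a_d}(\tau)$ be the imaginary part of $\operatorname{Li}_{a_1,\ldots,a_d}(e^{i\tau})$ if $w$ is even and its real part if $w$ is odd, and let $\operatorname{Gl}_{a_1,\ldots,a_d}(\tau)$ be the other of the two parts. Let $\binom{N}{a,b,c}=\frac{N!}{a!\,b!\,c!\,(N-a-b-c)!}$. The series $\operatorname{Li}_{s,\{1\}^b}(z)$ with $s\ge2$, $b\ge 0$, $|z|\le1$ and the integrals $\operatorname{Ls}_n^{(k)}(\tau)$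 with $0\le k\le n-1$, $0\le\tau\le2\pi$ converge absolutely, and the following hold. (a) For $0\le\tau\le2\pi$ and nonnegative integers $n,k$ with $n-k\ge2$, $$\zeta(n-k,\{1\}^k)-\sum_{j=0}^{k}\frac{(-i\tau)^j}{j!}\operatorname{Li}_{2+k-j,\{1\}^{n-k-2}}(e^{i\tau}) =\frac{i^{k+1}(-1)^{n-1}}{(n-1)!}\sum_{r=0}^{n-k-1}\sum_{m=0}^{r}\binom{n-1}{k,m,r-m}\left(\frac i2\right)^r(-\pi)^{r-m}\operatorname{Ls}_{n-(r-m)}^{(k+m)}(\tau).$$ (b) For all integers $0\le k\le n-1$, the function $\tau\mapsto\operatorname{Ls}_n^{(k)}(\tau)$ on $[0,2\pi]$ is a polynomial with rational coefficients (not depending on $\tau$) in $\pi$, $\tau$, multiple zeta values $\zeta(s,\{1\}^b)$, and the multiple Clausen and Glaisher functions $\operatorname{Cl}_{s,\{1\}^b}(\tau)$, $\operatorname{Gl}_{s,\{1\}^b}(\tau)$ (the real and imaginary parts of the Nielsen polylogarithms $\operatorname{Li}_{s,\{1\}^b}(e^{i\tau})$), with $s\ge2$, $b\ge0$. -/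

import Mathlib

noncomputable section

/-- The index set of a multiple polylogarithm of depth `d + 1`:
tuples of integers `n₁ > n₂ > ⋯ > n_{d+1} > 0`. -/
abbrev DecTuple (d : ℕ) : Type :=
  {n : Fin (d + 1) → ℕ // StrictAnti n ∧ ∀ i, 0 < n i}

/-- The general term `z^{n₁} / (n₁^{a₁} ⋯ n_{d+1}^{a_{d+1}})`. -/
def multiPolylogTerm {d : ℕ} (a : Fin (d + 1) → ℕ) (z : ℂ) (n : DecTuple d) : ℂ :=
  z ^ (n.1 0) / ∏ i, (n.1 i : ℂ) ^ (a i)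

/-- The multiple polylogarithm `Li_{a₁,…,a_{d+1}}(z)`. -/
def multiPolylog {d : ℕ} (a : Fin (d + 1) → ℕ) (z : ℂ) : ℂ :=
  ∑' n : DecTuple d, multiPolylogTerm a z n

/-- The multiple zeta value `ζ(a₁,…,a_{d+1})`. -/
def multiZeta {d : ℕ} (a : Fin (d + 1) → ℕ) : ℂ :=
  multiPolylog a 1

/-- The index string `(s, {1}^b)`. -/
def nielsenIndex (s b : ℕ) : Fin (b + 1) → ℕ :=
  Fin.cons (α := fun _ => ℕ) s (fun _ => 1)

open Classical in
/-- The multiple Clausen function. -/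
def multiClausen {d : ℕ} (a : Fin (d + 1) → ℕ) (θ : ℝ) : ℝ :=
  if Even (∑ i, a i) then (multiPolylog a (Complex.exp (Complex.I * θ))).im
  else (multiPolylog a (Complex.exp (Complex.I * θ))).re

open Classical in
/-- The multiple Glaisher function. -/
def multiGlaisher {d : ℕ} (a : Fin (d + 1) → ℕ) (θ : ℝ) : ℝ :=
  if Even (∑ i, a i) then (multiPolylog a (Complex.exp (Complex.I * θ))).re
  else (multiPolylog a (Complex.exp (Complex.I * θ))).im

/-- The integrand `θ^k log^{n-1-k} |2 sin(θ/2)|`; it is used only for `k + 1 ≤ n`, where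
the subtraction of natural numbers is exact. -/
def logSineIntegrand (n k : ℕ) (θ : ℝ) : ℝ :=
  θ ^ k * Real.log |2 * Real.sin (θ / 2)| ^ (n - 1 - k)

/-- The generalized log-sine integral `Ls_n^{(k)}(σ)`, for `k + 1 ≤ n`. -/
def logSine (n k : ℕ) (σ : ℝ) : ℝ :=
  -∫ θ in (0 : ℝ)..σ, logSineIntegrand n k θ

/-- The multinomial coefficient `N! / (a! b! c! (N - a - b - c)!)`, for `a + b + c ≤ N`. -/
def multinom3 (N a b c : ℕ) : ℚ :=
  (N.factorial : ℚ) /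
    (a.factorial * b.factorial * c.factorial * (N - a - b - c).factorial)

/-- The functions on `[0, 2π]` through which log-sine integrals are expressed: the constant `π`,
the identity `τ`, the multiple zeta values `ζ(s,{1}^b)` (as constants), and the multiple Clausen
and Glaisher functions of index `(s,{1}^b)`, with `s ≥ 2`; the last two are the real and imaginary
parts of the Nielsen polylogarithms at `e^{iτ}`. -/
inductive IsLogSineGenerator : (Set.Icc (0 : ℝ) (2 * Real.pi) → ℝ) → Prop
  | pi : IsLogSineGenerator (fun _ => Real.pi)
  | arg : IsLogSineGenerator (fun τ => (τ : ℝ))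
  | zeta (s b : ℕ) (hs : 2 ≤ s) :
      IsLogSineGenerator (fun _ => (multiZeta (nielsenIndex s b)).re)
  | clausen (s b : ℕ) (hs : 2 ≤ s) :
      IsLogSineGenerator (fun τ => multiClausen (nielsenIndex s b) τ)
  | glaisher (s b : ℕ) (hs : 2 ≤ s) :
      IsLogSineGenerator (fun τ => multiGlaisher (nielsenIndex s b) τ)

end

noncomputable section

open Filter Topology MeasureTheory

/-! Grouping by the largest summation index makes `Li_{s,{1}^b}` a power series with coefficients
c_b(n)/n^s. Inside the disc, z d/dz lowers s by one, and `nielsenLi_one` evaluates the bottom case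
as Li_{1,{1}^b}(z) = (-log(1-z))^(b+1)/(b+1)!. For (a), put b = n-k-2. Along z = r e^{it}, u = -it,
the derivative of ∑_{j≤k} u^j/j! Li_{2+k-j,{1}^b}(z) telescopes to i u^k/k! · Li_{1,{1}^b}(z)
(`hasDerivAt_nielsenSum`). Integrating over [0,τ] and letting r → 1 by dominated convergence gives
an integral of t^k log^(b+1)(1-e^{it}). Since log(1-e^{it}) = log|2 sin(t/2)| + i(t-π)/2, two
binomial expansions turn it into the double sum of log-sine integrals. The constant that appears is
ζ(k+2,{1}^b); the duality `nielsenLi_duality` replaces it by ζ(n-k,{1}^k). For (b), the r = 0 term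
of (a) is a nonzero rational multiple of Ls_n^{(k)}, and every other term has a smaller power of the
logarithm. Strong induction on n-1-k solves for Ls_n^{(k)} over ℚ and i, and the real part is then
taken. -/

/-! ### Coefficients of the Nielsen series: recursion and growth -/

/-- The decreasing tuples of length `b + 1` with largest entry `n`. -/
abbrev DecTupleHead (b n : ℕ) : Type := {t : DecTuple b // t.1 0 = n}

lemma DecTuple.le_head {b : ℕ} (t : DecTuple b) (i : Fin (b + 1)) : t.1 i ≤ t.1 0 :=
  t.2.1.antitone (Fin.zero_le i)

instance (b n : ℕ) : Finite (DecTupleHead b n) := by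
  refine Finite.of_injective
    (β := Set.Iic (fun _ : Fin (b + 1) => n)) (fun t => ⟨t.1.1, fun i => ?_⟩) ?_
  · exact (t.1.le_head i).trans_eq t.2
  · intro s t h
    exact Subtype.ext (Subtype.ext (Subtype.mk.inj h))

/-- Removing the largest entry of a decreasing tuple. -/
def decTupleHeadSuccEquiv (b n : ℕ) :
    DecTupleHead (b + 1) n ≃ Σ m : Fin n, DecTupleHead b m where
  toFun t := ⟨⟨t.1.1 (Fin.succ 0), by
      conv_rhs => rw [← t.2]
      exact t.1.2.1 (Fin.succ_pos 0)⟩,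
    ⟨⟨fun i => t.1.1 i.succ, fun _ _ h => t.1.2.1 (Fin.succ_lt_succ_iff.2 h),
      fun i => t.1.2.2 _⟩, rfl⟩⟩
  invFun p := ⟨⟨Fin.cons (α := fun _ => ℕ) n p.2.1.1, by
      have hlt : ∀ i, p.2.1.1 i < n := fun i =>
        ((p.2.1.le_head i).trans_eq p.2.2).trans_lt p.1.2
      constructor
      · intro i j hij
        induction j using Fin.cases with
        | zero => exact absurd hij (Fin.not_lt_zero i)
        | succ j =>
          induction i using Fin.cases with
          | zero => simpa using hlt j
          | succ i => simpa using p.2.1.2.1 (Fin.succ_lt_succ_iff.1 hij)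
      · intro i
        induction i using Fin.cases with
        | zero => simpa using (Nat.zero_le _).trans_lt (hlt 0)
        | succ i => simpa using p.2.1.2.2 i⟩, rfl⟩
  left_inv := by
    rintro ⟨⟨t, ht⟩, rfl⟩
    refine Subtype.ext (Subtype.ext (funext fun i => ?_))
    induction i using Fin.cases <;> simp
  right_inv := by
    rintro ⟨⟨m, hm⟩, ⟨⟨t, ht⟩, h⟩⟩
    simp only at h
    subst h
    rfl

/-- The inner sum `∑ 1 / (n₂ ⋯ n_{b+1})` over `n > n₂ > ⋯ > n_{b+1} > 0`. -/
def nielsenCoeff (b n : ℕ) : ℝ :=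
  ∑' t : DecTupleHead b n, ∏ i : Fin b, ((t.1.1 i.succ : ℕ) : ℝ)⁻¹

lemma nielsenCoeff_zero_right (b : ℕ) : nielsenCoeff b 0 = 0 := by
  have : IsEmpty (DecTupleHead b 0) := ⟨fun t => (t.1.2.2 0).ne' t.2⟩
  exact tsum_empty

lemma nielsenCoeff_zero_left {n : ℕ} (hn : n ≠ 0) : nielsenCoeff 0 n = 1 := by
  have : Unique (DecTupleHead 0 n) :=
    { default := ⟨⟨fun _ => n, fun i j h => absurd h (by omega), fun _ => Nat.pos_of_ne_zero hn⟩, rfl⟩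
      uniq := fun t => Subtype.ext (Subtype.ext (funext fun i => by
        rw [show i = 0 by omega]; exact t.2)) }
  rw [nielsenCoeff, tsum_fintype]
  simp

lemma nielsenCoeff_nonneg (b n : ℕ) : 0 ≤ nielsenCoeff b n :=
  tsum_nonneg fun _ => Finset.prod_nonneg fun _ _ => by positivity

/-- The index m is the second largest entry n₂; it contributes the factor 1/m, and the remaining
entries form the same sum one level down. -/
lemma nielsenCoeff_succ_left (b n : ℕ) :
    nielsenCoeff (b + 1) n = ∑ m ∈ Finset.range n, nielsenCoeff b m / m := by
  have := fun b n => Fintype.ofFinite (DecTupleHead b n)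
  rw [nielsenCoeff, ← (decTupleHeadSuccEquiv b n).symm.tsum_eq, tsum_fintype,
    Fintype.sum_sigma, ← Fin.sum_univ_eq_sum_range (fun m => nielsenCoeff b m / m)]
  refine Finset.sum_congr rfl fun m _ => ?_
  rw [nielsenCoeff, tsum_fintype, Finset.sum_div]
  refine Finset.sum_congr rfl fun t _ => ?_
  rw [Fin.prod_univ_succ]
  have h0 : ((decTupleHeadSuccEquiv b n).symm ⟨m, t⟩).1.1 (Fin.succ 0) = m := t.2
  rw [h0, div_eq_inv_mul]
  rfl

lemma nielsenCoeff_succ_succ (b n : ℕ) :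
    nielsenCoeff (b + 1) (n + 1) = nielsenCoeff (b + 1) n + nielsenCoeff b n / n := by
  rw [nielsenCoeff_succ_left, nielsenCoeff_succ_left, Finset.sum_range_succ]

/-- Dropping the ordering lets each of the b inner indices range freely up to n. This logarithmic
growth is what makes the series converge already for s = 2. -/
lemma nielsenCoeff_le_harmonic_pow (b n : ℕ) : nielsenCoeff b n ≤ (harmonic n : ℝ) ^ b := by
  have hmono : ∀ {m n : ℕ}, m ≤ n → harmonic m ≤ harmonic n := fun {m n} h =>
    Finset.sum_le_sum_of_subset_of_nonneg (Finset.range_mono h) fun _ _ _ => by positivity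
  have hpos : ∀ n, 0 ≤ harmonic n := fun n => Finset.sum_nonneg fun _ _ => by positivity
  induction b generalizing n with
  | zero =>
    rcases eq_or_ne n 0 with rfl | hn
    · simp [nielsenCoeff_zero_right]
    · simp [nielsenCoeff_zero_left hn]
  | succ b ih =>
    induction n with
    | zero => rw [nielsenCoeff_zero_right]; simp
    | succ n _ =>
      rw [nielsenCoeff_succ_left, Finset.sum_range_succ']
      simp only [nielsenCoeff_zero_right, zero_div, add_zero]
      calc ∑ m ∈ Finset.range n, nielsenCoeff b (m + 1) / ((m + 1 : ℕ) : ℝ)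
          ≤ ∑ m ∈ Finset.range n, (harmonic (n + 1) : ℝ) ^ b * ((m + 1 : ℕ) : ℝ)⁻¹ := by
            refine Finset.sum_le_sum fun m hm => ?_
            rw [div_eq_mul_inv]
            refine mul_le_mul_of_nonneg_right ((ih _).trans ?_) (by positivity)
            refine pow_le_pow_left₀ (by exact_mod_cast hpos _) ?_ _
            exact_mod_cast hmono (by have := Finset.mem_range.1 hm; omega)
        _ = (harmonic (n + 1) : ℝ) ^ b * (harmonic n : ℝ) := by
            rw [← Finset.mul_sum]; simp [harmonic]
        _ ≤ (harmonic (n + 1) : ℝ) ^ (b + 1) := by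
            rw [pow_succ]
            refine mul_le_mul_of_nonneg_left ?_ (pow_nonneg (by exact_mod_cast hpos _) _)
            exact_mod_cast hmono n.le_succ

lemma nielsenCoeff_le_pow (b n : ℕ) : nielsenCoeff b n ≤ (n : ℝ) ^ b := by
  refine (nielsenCoeff_le_harmonic_pow b n).trans ?_
  have hpos : 0 ≤ harmonic n := Finset.sum_nonneg fun _ _ => by positivity
  have hle : harmonic n ≤ n := by
    calc harmonic n ≤ ∑ _i ∈ Finset.range n, (1 : ℚ) :=
          Finset.sum_le_sum fun i _ => by
            push_cast
            exact inv_le_one_of_one_le₀ (by linarith [(Nat.cast_nonneg i : (0 : ℚ) ≤ i)])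
      _ = n := by simp
  exact pow_le_pow_left₀ (by exact_mod_cast hpos) (by exact_mod_cast hle) _

lemma summable_nielsenCoeff_div {s : ℕ} (hs : 2 ≤ s) (b : ℕ) :
    Summable fun n : ℕ => nielsenCoeff b n / (n : ℝ) ^ s := by
  have hO : (fun n : ℕ => (1 + Real.log n) ^ b) =O[Filter.atTop]
      fun n : ℕ => (n : ℝ) ^ (1 / 2 : ℝ) := by
    have h1 : (fun x : ℝ => (1 + Real.log x) ^ b) =O[Filter.atTop] fun x => Real.log x ^ b := by
      refine Asymptotics.IsBigO.pow (Asymptotics.IsBigO.add ?_ (Asymptotics.isBigO_refl _ _)) b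
      exact (Real.isLittleO_const_log_atTop (c := 1)).isBigO
    have h2 : (fun x : ℝ => Real.log x ^ b) =O[Filter.atTop] fun x => x ^ (1 / 2 : ℝ) := by
      simpa using (isLittleO_log_rpow_rpow_atTop (s := 1 / 2) (b : ℝ) (by norm_num)).isBigO
    exact (h1.trans h2).comp_tendsto tendsto_natCast_atTop_atTop
  -- The logarithms cost at most n^(1/2), leaving the convergent exponent -3/2.
  have hsum : Summable fun n : ℕ => (1 + Real.log n) ^ b / (n : ℝ) ^ 2 := by
    refine summable_of_isBigO_nat (g := fun n : ℕ => (n : ℝ) ^ (-(3 / 2) : ℝ))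
      (Real.summable_nat_rpow.2 (by norm_num)) ?_
    have h := hO.mul (Asymptotics.isBigO_refl (fun n : ℕ => ((n : ℝ) ^ 2)⁻¹) Filter.atTop)
    refine (h.congr_left fun n => (div_eq_mul_inv _ _).symm).trans
      (Filter.EventuallyEq.isBigO ?_)
    filter_upwards [Filter.eventually_gt_atTop 0] with n hn
    have hn' : (0 : ℝ) < n := by exact_mod_cast hn
    rw [← Real.rpow_natCast, ← Real.rpow_neg hn'.le, ← Real.rpow_add hn']
    norm_num
  refine hsum.of_nonneg_of_le (fun n => div_nonneg (nielsenCoeff_nonneg b n) (by positivity))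
    fun n => ?_
  rcases Nat.eq_zero_or_pos n with rfl | hn
  · simp [nielsenCoeff_zero_right]
  have h1 : (1 : ℝ) ≤ n := by exact_mod_cast hn
  refine div_le_div₀ (pow_nonneg (by linarith [Real.log_nonneg h1]) _) ?_ (by positivity)
    (pow_le_pow_right₀ h1 hs)
  refine (nielsenCoeff_le_harmonic_pow b n).trans (pow_le_pow_left₀ ?_ (harmonic_le_one_add_log n) _)
  exact_mod_cast (Finset.sum_nonneg fun _ _ => by positivity : 0 ≤ harmonic n)

/-! ### Nielsen polylogarithms as power series and their derivatives -/

/-- The power series of `Li_{s,{1}^b}`. -/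
def nielsenLi (s b : ℕ) (z : ℂ) : ℂ :=
  ∑' n : ℕ, ((nielsenCoeff b n / (n : ℝ) ^ s : ℝ) : ℂ) * z ^ n

lemma multiPolylogTerm_nielsenIndex (s b : ℕ) (z : ℂ) (t : DecTuple b) :
    multiPolylogTerm (nielsenIndex s b) z t
      = z ^ t.1 0 / (t.1 0 : ℂ) ^ s * ((∏ i : Fin b, (t.1 i.succ : ℝ)⁻¹ : ℝ) : ℂ) := by
  rw [multiPolylogTerm, Fin.prod_univ_succ]
  simp [nielsenIndex, div_eq_mul_inv, mul_assoc, mul_comm]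

lemma hasSum_multiPolylogTerm_fiber (s b : ℕ) (z : ℂ) (n : ℕ) :
    HasSum (fun t : DecTupleHead b n => multiPolylogTerm (nielsenIndex s b) z t.1)
      (((nielsenCoeff b n / (n : ℝ) ^ s : ℝ) : ℂ) * z ^ n) := by
  have h : HasSum (fun t : DecTupleHead b n => ∏ i : Fin b, ((t.1.1 i.succ : ℕ) : ℝ)⁻¹)
      (nielsenCoeff b n) := Summable.of_finite.hasSum
  have h' := (Complex.hasSum_ofReal.2 h).mul_left (z ^ n / (n : ℂ) ^ s)
  rw [show ((nielsenCoeff b n / (n : ℝ) ^ s : ℝ) : ℂ) * z ^ n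
    = z ^ n / (n : ℂ) ^ s * (nielsenCoeff b n : ℂ) by push_cast; ring]
  refine h'.congr_fun fun t => ?_
  rw [multiPolylogTerm_nielsenIndex, t.2]

lemma norm_multiPolylogTerm_le {s b : ℕ} {z : ℂ} (hz : ‖z‖ ≤ 1) (t : DecTuple b) :
    ‖multiPolylogTerm (nielsenIndex s b) z t‖
      ≤ ‖multiPolylogTerm (nielsenIndex s b) 1 t‖ := by
  rw [multiPolylogTerm, multiPolylogTerm, norm_div, norm_div, one_pow, norm_one, norm_pow]
  gcongr
  exact pow_le_one₀ (norm_nonneg _) hz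

/-- The terms at z = 1 are nonnegative and dominate all others, so it suffices to sum them over the
fibres of the largest index. -/
lemma summable_multiPolylogTerm {s : ℕ} (hs : 2 ≤ s) (b : ℕ) {z : ℂ} (hz : ‖z‖ ≤ 1) :
    Summable (multiPolylogTerm (nielsenIndex s b) z) := by
  have hnorm : ∀ t : DecTuple b, ((‖multiPolylogTerm (nielsenIndex s b) 1 t‖ : ℝ) : ℂ)
      = multiPolylogTerm (nielsenIndex s b) 1 t := by
    intro t
    rw [multiPolylogTerm_nielsenIndex, norm_mul, Complex.norm_real, Real.norm_of_nonneg
      (Finset.prod_nonneg fun _ _ => by positivity)]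
    simp
  refine Summable.of_norm_bounded ?_ (norm_multiPolylogTerm_le hz)
  rw [← (Equiv.sigmaFiberEquiv fun t : DecTuple b => t.1 0).summable_iff]
  refine (summable_sigma_of_nonneg fun _ => norm_nonneg _).2 ?_
  have hfib : ∀ n : ℕ, HasSum
      (fun t : DecTupleHead b n => ‖multiPolylogTerm (nielsenIndex s b) 1 t.1‖)
      (nielsenCoeff b n / (n : ℝ) ^ s) := by
    intro n
    rw [← Complex.hasSum_ofReal]
    simpa [hnorm] using hasSum_multiPolylogTerm_fiber s b 1 n
  refine ⟨fun n => (hfib n).summable, ?_⟩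
  exact (summable_nielsenCoeff_div hs b).congr fun n => ((hfib n).tsum_eq).symm

lemma multiPolylog_nielsenIndex {s : ℕ} (hs : 2 ≤ s) (b : ℕ) {z : ℂ} (hz : ‖z‖ ≤ 1) :
    multiPolylog (nielsenIndex s b) z = nielsenLi s b z := by
  have hsum := (Equiv.sigmaFiberEquiv fun t : DecTuple b => t.1 0).summable_iff.2
    (summable_multiPolylogTerm hs b hz)
  rw [multiPolylog, ← (Equiv.sigmaFiberEquiv fun t : DecTuple b => t.1 0).tsum_eq]
  refine (hsum.tsum_sigma).trans ?_
  exact tsum_congr fun n => (hasSum_multiPolylogTerm_fiber s b z n).tsum_eq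

lemma summable_mul_pow_of_norm_le_pow {c : ℕ → ℂ} {K : ℕ} (hc : ∀ n, ‖c n‖ ≤ (n : ℝ) ^ K)
    {z : ℂ} (hz : ‖z‖ < 1) : Summable fun n => c n * z ^ n := by
  refine Summable.of_norm_bounded (summable_pow_mul_geometric_of_norm_lt_one K
    (r := ‖z‖) (by simpa using hz)) fun n => ?_
  rw [norm_mul, norm_pow]
  gcongr
  exact hc n

lemma hasDerivAt_tsum_mul_pow {c : ℕ → ℂ} {K : ℕ} (hc : ∀ n, ‖c n‖ ≤ (n : ℝ) ^ K)
    {z : ℂ} (hz : ‖z‖ < 1) :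
    HasDerivAt (fun z => ∑' n, c n * z ^ n) (∑' n, c n * (n * z ^ (n - 1))) z := by
  obtain ⟨r, hzr, hr1⟩ := exists_between hz
  have hr0 : 0 < r := (norm_nonneg z).trans_lt hzr
  -- This majorant is n^(K+1) r^(n-1), written without truncated subtraction; it bounds the
  -- differentiated terms uniformly on the ball of radius r.
  have hu : Summable fun n : ℕ => ((n : ℝ) ^ (K + 1) * r ^ n) / r :=
    (summable_pow_mul_geometric_of_norm_lt_one (K + 1) (r := r)
      (by rwa [Real.norm_of_nonneg hr0.le])).div_const r
  refine hasDerivAt_tsum_of_isPreconnected (t := Metric.ball (0 : ℂ) r) hu Metric.isOpen_ball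
    (convex_ball _ _).isPreconnected
    (fun n y _ => (hasDerivAt_pow n y).const_mul (c n)) ?_ (y₀ := z) (by simpa using hzr)
    (summable_mul_pow_of_norm_le_pow hc hz) (by simpa using hzr)
  intro n y hy
  rcases n with _ | n
  · simp
  have hy' : ‖y‖ ≤ r := by simpa using (mem_ball_zero_iff.1 hy).le
  have hn := hc (n + 1)
  rw [norm_mul, norm_mul, norm_pow, Complex.norm_natCast, Nat.add_sub_cancel, pow_succ r,
    ← mul_assoc, ← mul_assoc, mul_div_cancel_right₀ _ hr0.ne', pow_succ _ K]
  gcongr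

lemma norm_nielsenCoeff_div_le (s b n : ℕ) :
    ‖((nielsenCoeff b n / (n : ℝ) ^ s : ℝ) : ℂ)‖ ≤ (n : ℝ) ^ b := by
  rw [Complex.norm_real, Real.norm_of_nonneg
    (div_nonneg (nielsenCoeff_nonneg b n) (by positivity))]
  rcases Nat.eq_zero_or_pos n with rfl | hn
  · rw [nielsenCoeff_zero_right, zero_div]; positivity
  · exact (div_le_self (nielsenCoeff_nonneg b n)
      (one_le_pow₀ (by exact_mod_cast hn))).trans (nielsenCoeff_le_pow b n)

lemma hasDerivAt_nielsenLi_tsum (s b : ℕ) {z : ℂ} (hz : ‖z‖ < 1) :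
    HasDerivAt (nielsenLi s b)
      (∑' n : ℕ, ((nielsenCoeff b n / (n : ℝ) ^ s : ℝ) : ℂ) * (n * z ^ (n - 1))) z :=
  hasDerivAt_tsum_mul_pow (norm_nielsenCoeff_div_le s b) hz

lemma mul_tsum_nielsenCoeff (s b : ℕ) (z : ℂ) :
    z * (∑' n : ℕ, ((nielsenCoeff b n / (n : ℝ) ^ (s + 1) : ℝ) : ℂ) * (n * z ^ (n - 1)))
      = nielsenLi s b z := by
  rw [nielsenLi, ← tsum_mul_left]
  refine tsum_congr fun n => ?_
  rcases n with _ | n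
  · simp [nielsenCoeff_zero_right]
  · have : ((n : ℂ) + 1) ≠ 0 := by exact_mod_cast n.succ_ne_zero
    push_cast
    field_simp
    ring

lemma hasDerivAt_nielsenLi (s b : ℕ) {z : ℂ} (hz : ‖z‖ < 1) (h0 : z ≠ 0) :
    HasDerivAt (nielsenLi (s + 1) b) (nielsenLi s b z / z) z := by
  rw [← mul_tsum_nielsenCoeff, mul_div_cancel_left₀ _ h0]
  exact hasDerivAt_nielsenLi_tsum (s + 1) b hz

lemma nielsenLi_apply_zero (s b : ℕ) : nielsenLi s b 0 = 0 := by
  rw [nielsenLi, tsum_eq_single 0]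
  · simp [nielsenCoeff_zero_right]
  · intro n hn; simp [hn]

/-- Weierstrass M-test. Continuity up to the unit circle is what allows radial limits to be taken
later. -/
lemma continuousOn_nielsenLi {s : ℕ} (hs : 2 ≤ s) (b : ℕ) :
    ContinuousOn (nielsenLi s b) (Metric.closedBall 0 1) := by
  refine continuousOn_tsum (fun n => by fun_prop) (summable_nielsenCoeff_div hs b) fun n z hz => ?_
  rw [norm_mul, norm_pow, Complex.norm_real, Real.norm_of_nonneg
    (div_nonneg (nielsenCoeff_nonneg b n) (by positivity))]
  exact mul_le_of_le_one_right (div_nonneg (nielsenCoeff_nonneg b n) (by positivity))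
    (pow_le_one₀ (norm_nonneg _) (by simpa using hz))

lemma one_sub_mem_slitPlane {z : ℂ} (hz : ‖z‖ < 1) : 1 - z ∈ Complex.slitPlane := by
  left
  have := (Complex.re_le_norm z).trans_lt hz
  simpa using this

/-- The derivative is ∑ c_{b+1}(n+1) z^n; multiplying by 1-z takes differences of consecutive
coefficients, which are c_b(n)/n. -/
lemma hasDerivAt_nielsenLi_one_succ (b : ℕ) {z : ℂ} (hz : ‖z‖ < 1) :
    HasDerivAt (nielsenLi 1 (b + 1)) (nielsenLi 1 b z / (1 - z)) z := by
  have h1 : (1 - z) ≠ 0 := Complex.slitPlane_ne_zero (one_sub_mem_slitPlane hz)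
  convert hasDerivAt_nielsenLi_tsum 1 (b + 1) hz using 1
  rw [div_eq_iff h1]
  have hs0 : Summable fun n : ℕ => (nielsenCoeff (b + 1) n : ℂ) * z ^ n := by
    simpa using summable_mul_pow_of_norm_le_pow (norm_nielsenCoeff_div_le 0 (b + 1)) hz
  have hs1 : Summable fun n : ℕ => ((nielsenCoeff b n / (n : ℝ) ^ 1 : ℝ) : ℂ) * z ^ n :=
    summable_mul_pow_of_norm_le_pow (norm_nielsenCoeff_div_le 1 b) hz
  have hshift : ∀ n : ℕ, ((nielsenCoeff (b + 1) (n + 1) : ℝ) : ℂ) * z ^ n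
      = (nielsenCoeff (b + 1) n : ℂ) * z ^ n
        + ((nielsenCoeff b n / (n : ℝ) ^ 1 : ℝ) : ℂ) * z ^ n := by
    intro n
    rw [nielsenCoeff_succ_succ]; push_cast; ring
  have hs2 : Summable fun n : ℕ => ((nielsenCoeff (b + 1) (n + 1) : ℝ) : ℂ) * z ^ n :=
    (hs0.add hs1).congr fun n => (hshift n).symm
  have hterm : ∀ n : ℕ, ((nielsenCoeff (b + 1) (n + 1) / ((n + 1 : ℕ) : ℝ) ^ 1 : ℝ) : ℂ)
      * (((n + 1 : ℕ) : ℂ) * z ^ (n + 1 - 1))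
      = ((nielsenCoeff (b + 1) (n + 1) : ℝ) : ℂ) * z ^ n := by
    intro n
    have : ((n : ℂ) + 1) ≠ 0 := by exact_mod_cast n.succ_ne_zero
    push_cast
    field_simp
  have hD : ∑' n : ℕ, ((nielsenCoeff (b + 1) n / (n : ℝ) ^ 1 : ℝ) : ℂ) * (n * z ^ (n - 1))
      = ∑' n : ℕ, ((nielsenCoeff (b + 1) (n + 1) : ℝ) : ℂ) * z ^ n := by
    rw [tsum_eq_zero_add' (hs2.congr fun n => (hterm n).symm)]
    simp only [hterm]
    simp
  have hE : ∑' n : ℕ, (nielsenCoeff (b + 1) n : ℂ) * z ^ n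
      = (∑' n : ℕ, ((nielsenCoeff (b + 1) (n + 1) : ℝ) : ℂ) * z ^ n) * z := by
    rw [hs0.tsum_eq_zero_add, ← tsum_mul_right]
    simp [nielsenCoeff_zero_right, pow_succ, mul_assoc]
  have hF : ∑' n : ℕ, ((nielsenCoeff (b + 1) (n + 1) : ℝ) : ℂ) * z ^ n
      = ∑' n : ℕ, (nielsenCoeff (b + 1) n : ℂ) * z ^ n + nielsenLi 1 b z := by
    rw [nielsenLi, ← hs0.tsum_add hs1]
    exact tsum_congr hshift
  rw [hD, mul_sub, mul_one, ← hE, hF]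
  ring

lemma hasDerivAt_neg_log_one_sub {z : ℂ} (hz : 1 - z ∈ Complex.slitPlane) :
    HasDerivAt (fun z => -Complex.log (1 - z)) (1 / (1 - z)) z := by
  have := (((hasDerivAt_id z).const_sub 1).clog hz).neg
  refine this.congr_deriv ?_
  simp [neg_div]

/-- Induction on b: both sides vanish at 0 and have the same derivative on the disc. The base case
is the Taylor series of the logarithm. -/
lemma nielsenLi_one (b : ℕ) {z : ℂ} (hz : ‖z‖ < 1) :
    nielsenLi 1 b z = (-Complex.log (1 - z)) ^ (b + 1) / ((b + 1).factorial : ℂ) := by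
  induction b generalizing z with
  | zero =>
    rw [zero_add, pow_one, Nat.factorial_one, Nat.cast_one, div_one,
      ← (Complex.hasSum_taylorSeries_neg_log hz).tsum_eq]
    refine tsum_congr fun n => ?_
    rcases eq_or_ne n 0 with rfl | hn
    · simp [nielsenCoeff_zero_right]
    · simp [nielsenCoeff_zero_left hn, div_eq_inv_mul]
  | succ b ih =>
    have hd : ∀ w ∈ Metric.ball (0 : ℂ) 1, HasDerivAt
        (fun z => (-Complex.log (1 - z)) ^ (b + 1 + 1) / ((b + 1 + 1).factorial : ℂ))
        (nielsenLi 1 b w / (1 - w)) w := by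
      intro w hw
      have hw1 : ‖w‖ < 1 := by simpa using hw
      refine (((hasDerivAt_neg_log_one_sub (one_sub_mem_slitPlane hw1)).pow
        (b + 1 + 1)).div_const _).congr_deriv ?_
      rw [ih hw1, Nat.factorial_succ (b + 1)]
      have h1 := Complex.slitPlane_ne_zero (one_sub_mem_slitPlane hw1)
      have h2 : ((b + 1).factorial : ℂ) ≠ 0 := by exact_mod_cast (b + 1).factorial_ne_zero
      have h3 : ((b : ℂ) + 1 + 1) ≠ 0 := by exact_mod_cast (b + 1).succ_ne_zero
      push_cast
      field_simp
    have hd' : ∀ w ∈ Metric.ball (0 : ℂ) 1, HasDerivAt (nielsenLi 1 (b + 1))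
        (nielsenLi 1 b w / (1 - w)) w := fun w hw =>
      hasDerivAt_nielsenLi_one_succ b (by simpa using hw)
    refine Metric.isOpen_ball.eqOn_of_deriv_eq (x := (0 : ℂ)) (convex_ball _ _).isPreconnected
      (fun w hw => (hd' w hw).differentiableAt.differentiableWithinAt)
      (fun w hw => (hd w hw).differentiableAt.differentiableWithinAt)
      (fun w hw => by rw [(hd' w hw).deriv, (hd w hw).deriv]) (by simp) ?_ (by simpa using hz)
    simp [nielsenLi_apply_zero]

/-! ### The telescoping combination -/

/-- The combination `∑_{j ≤ k} u^j / j! Li_{2+k-j,{1}^b}(z)`. -/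
def nielsenSum (k b : ℕ) (u z : ℂ) : ℂ :=
  ∑ j ∈ Finset.range (k + 1), u ^ j / (j.factorial : ℂ) * nielsenLi (2 + k - j) b z

lemma nielsenSum_zero_left (k b : ℕ) (z : ℂ) : nielsenSum k b 0 z = nielsenLi (2 + k) b z := by
  rw [nielsenSum, Finset.sum_range_succ']
  simp

/-- Along a curve with `z' = q z` and `u' = -q` the derivative of `nielsenSum` telescopes. -/
lemma hasDerivAt_nielsenSum (k b : ℕ) {u z : ℝ → ℂ} {q : ℂ} {t : ℝ}
    (hu : HasDerivAt u (-q) t) (hz : HasDerivAt z (q * z t) t) (hz1 : ‖z t‖ < 1)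
    (hz0 : z t ≠ 0) :
    HasDerivAt (fun t => nielsenSum k b (u t) (z t))
      (q * (u t ^ k / (k.factorial : ℂ)) * nielsenLi 1 b (z t)) t := by
  -- Differentiating Li in the j-th summand gives T (j+1), and differentiating u^j gives -T j. The
  -- factor j makes T 0 = 0, so only T (k+1) survives.
  set T : ℕ → ℂ := fun j =>
    q * (j * u t ^ (j - 1) / (j.factorial : ℂ)) * nielsenLi (2 + k - j) b (z t) with hT
  have hfac : ∀ j : ℕ, ((j + 1 : ℕ) : ℂ) * u t ^ j / ((j + 1).factorial : ℂ)
      = u t ^ j / (j.factorial : ℂ) := by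
    intro j
    have h1 : (j.factorial : ℂ) ≠ 0 := by exact_mod_cast j.factorial_ne_zero
    have h2 : ((j : ℂ) + 1) ≠ 0 := by exact_mod_cast j.succ_ne_zero
    rw [Nat.factorial_succ]
    push_cast
    field_simp
  have hterm : ∀ j ∈ Finset.range (k + 1), HasDerivAt
      (fun t => u t ^ j / (j.factorial : ℂ) * nielsenLi (2 + k - j) b (z t))
      (T (j + 1) - T j) t := by
    intro j hj
    have hj' : 2 + k - j = (2 + k - (j + 1)) + 1 := by
      have := Finset.mem_range.1 hj; omega
    have hL : HasDerivAt (fun t => nielsenLi (2 + k - j) b (z t))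
        ((q * z t) • (nielsenLi (2 + k - (j + 1)) b (z t) / z t)) t := by
      rw [hj']
      exact (hasDerivAt_nielsenLi _ b hz1 hz0).scomp t hz
    refine (((hu.fun_pow j).div_const (j.factorial : ℂ)).fun_mul hL).congr_deriv ?_
    simp only [hT, hfac, Nat.add_sub_cancel, smul_eq_mul]
    field_simp
    ring
  refine (HasDerivAt.fun_sum hterm).congr_deriv ?_
  rw [Finset.sum_range_sub]
  simp only [hT, hfac, Nat.add_sub_cancel, show 2 + k - (k + 1) = 1 by omega]
  simp

/-! ### Boundary limits and duality of zeta values -/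

lemma tendsto_log_pow_mul_nielsenLi_nhdsGT_zero (j s b : ℕ) :
    Tendsto (fun x : ℝ => (-(Real.log x : ℂ)) ^ j * nielsenLi s b x) (𝓝[>] 0) (𝓝 0) := by
  have hlog : (fun x : ℝ => (-(Real.log x : ℂ)) ^ j) =O[𝓝[>] 0] fun x : ℝ => x ^ (-(1 / 2) : ℝ) := by
    have h := (isLittleO_abs_log_rpow_rpow_nhdsGT_zero (s := -(1 / 2)) (j : ℝ) (by norm_num)).isBigO
    refine Asymptotics.IsBigO.trans (Asymptotics.isBigO_of_le _ fun x => ?_) h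
    rw [Real.rpow_natCast, norm_pow, norm_neg, Complex.norm_real, norm_pow, Real.norm_eq_abs,
      Real.norm_eq_abs, abs_abs]
  have hLi : (fun x : ℝ => nielsenLi s b x) =O[𝓝[>] 0] fun x : ℝ => x := by
    have h := (hasDerivAt_nielsenLi_tsum s b (z := 0) (by simp)).isBigO_sub
    simp only [nielsenLi_apply_zero, sub_zero] at h
    have ht : Tendsto (fun x : ℝ => (x : ℂ)) (𝓝[>] 0) (𝓝 0) :=
      (Complex.continuous_ofReal.tendsto' 0 0 (by simp)).mono_left nhdsWithin_le_nhds
    refine (h.comp_tendsto ht).trans (Asymptotics.isBigO_of_le _ fun x => ?_)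
    simp
  refine (hlog.mul hLi).trans_tendsto ?_
  have ht : Tendsto (fun x : ℝ => x ^ (1 / 2 : ℝ)) (𝓝[>] 0) (𝓝 0) :=
    ((Real.continuous_rpow_const (by norm_num)).tendsto' 0 0 (by simp)).mono_left
      nhdsWithin_le_nhds
  refine ht.congr' ?_
  filter_upwards [self_mem_nhdsWithin] with x hx
  have hx' : 0 < x := hx
  conv_rhs => rw [← Real.rpow_one x]
  rw [← Real.rpow_mul hx'.le, ← Real.rpow_add hx']
  norm_num

lemma tendsto_nielsenSum_nhdsGT_zero (k b : ℕ) :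
    Tendsto (fun x : ℝ => nielsenSum k b (-(Real.log x : ℂ)) x) (𝓝[>] 0) (𝓝 0) := by
  have h : Tendsto (fun x : ℝ => nielsenSum k b (-(Real.log x : ℂ)) x) (𝓝[>] 0)
      (𝓝 (∑ j ∈ Finset.range (k + 1), 0 / (j.factorial : ℂ))) := by
    refine tendsto_finsetSum _ fun j _ => ?_
    refine ((tendsto_log_pow_mul_nielsenLi_nhdsGT_zero j (2 + k - j) b).div_const
      (j.factorial : ℂ)).congr fun x => ?_
    ring
  simpa using h

lemma tendsto_nielsenSum {α : Type*} {l : Filter α} (k b : ℕ) {u z : α → ℂ} {u₀ z₀ : ℂ}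
    (hu : Tendsto u l (𝓝 u₀)) (hz : Tendsto z l (𝓝 z₀)) (hz₀ : ‖z₀‖ ≤ 1)
    (hz1 : ∀ᶠ x in l, ‖z x‖ ≤ 1) :
    Tendsto (fun x => nielsenSum k b (u x) (z x)) l (𝓝 (nielsenSum k b u₀ z₀)) := by
  refine tendsto_finsetSum _ fun j hj => ((hu.pow j).div_const _).mul ?_
  have hc := continuousOn_nielsenLi (s := 2 + k - j)
    (by have := Finset.mem_range.1 hj; omega) b z₀ (by simpa using hz₀)
  exact hc.tendsto.comp (tendsto_nhdsWithin_iff.2 ⟨hz, by simpa using hz1⟩)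

lemma tendsto_nielsenSum_one_sub_nhdsGT_zero (k b : ℕ) :
    Tendsto (fun x : ℝ => nielsenSum k b (-(Real.log (1 - x) : ℂ)) ((1 - x : ℝ) : ℂ)) (𝓝[>] 0)
      (𝓝 (nielsenLi (2 + k) b 1)) := by
  rw [← nielsenSum_zero_left]
  have h1 : Tendsto (fun x : ℝ => 1 - x) (𝓝[>] 0) (𝓝 1) :=
    ((continuous_const.sub continuous_id).tendsto' 0 1 (by simp)).mono_left nhdsWithin_le_nhds
  refine tendsto_nielsenSum k b ?_ ?_ (by simp) ?_
  · have := ((Real.continuousAt_log one_ne_zero).tendsto.comp h1).ofReal.neg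
    simpa using this
  · simpa using h1.ofReal
  · filter_upwards [Ioo_mem_nhdsGT (zero_lt_one (α := ℝ))] with x hx
    rw [Complex.norm_real, Real.norm_of_nonneg (by linarith [hx.2])]
    linarith [hx.1]

/-- A function which does not depend on `x ∈ (0, 1)` and whose values near the two end points
are the two sides of the duality relation. -/
def nielsenDual (k b : ℕ) (x : ℝ) : ℂ :=
  nielsenSum k b (-(Real.log x : ℂ)) x
    + nielsenSum b k (-(Real.log (1 - x) : ℂ)) ((1 - x : ℝ) : ℂ)
    + (-(Real.log x : ℂ)) ^ (k + 1) / ((k + 1).factorial : ℂ)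
      * ((-(Real.log (1 - x) : ℂ)) ^ (b + 1) / ((b + 1).factorial : ℂ))

/-- This reduces the limit at 1 to the limit at 0 with k and b exchanged. -/
lemma nielsenDual_symm (k b : ℕ) (x : ℝ) : nielsenDual k b (1 - x) = nielsenDual b k x := by
  simp only [nielsenDual, sub_sub_cancel]
  ring

lemma nielsenLi_one_ofReal (b : ℕ) {x : ℝ} (hx : x ∈ Set.Ioo (0 : ℝ) 1) :
    nielsenLi 1 b x = (-(Real.log (1 - x) : ℂ)) ^ (b + 1) / ((b + 1).factorial : ℂ) := by
  rw [nielsenLi_one b (by rw [Complex.norm_real, Real.norm_of_nonneg hx.1.le]; exact hx.2),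
    Complex.ofReal_log (by linarith [hx.2])]
  push_cast
  rfl

lemma tendsto_nielsenDual (k b : ℕ) :
    Tendsto (nielsenDual k b) (𝓝[>] 0) (𝓝 (nielsenLi (2 + b) k 1)) := by
  -- The factor in log(1-x) is Li_{1,{1}^b}(x), which is O(x) and beats the powers of log x.
  have hP : Tendsto (fun x : ℝ => (-(Real.log x : ℂ)) ^ (k + 1) / ((k + 1).factorial : ℂ)
      * ((-(Real.log (1 - x) : ℂ)) ^ (b + 1) / ((b + 1).factorial : ℂ))) (𝓝[>] 0) (𝓝 0) := by
    have h := (tendsto_log_pow_mul_nielsenLi_nhdsGT_zero (k + 1) 1 b).div_const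
      ((k + 1).factorial : ℂ)
    rw [zero_div] at h
    refine h.congr' ?_
    filter_upwards [Ioo_mem_nhdsGT (zero_lt_one (α := ℝ))] with x hx
    rw [nielsenLi_one_ofReal b hx]
    ring
  simpa only [zero_add, add_zero] using! ((tendsto_nielsenSum_nhdsGT_zero k b).add
    (tendsto_nielsenSum_one_sub_nhdsGT_zero b k)).add hP

/-- The two sums telescope to (1/x) u^k/k! · v^(b+1)/(b+1)! and -(1/(1-x)) v^b/b! · u^(k+1)/(k+1)!,
with u = -log x and v = -log(1-x). By the product rule these cancel the derivative of the third
summand. -/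
lemma hasDerivAt_nielsenDual (k b : ℕ) {x : ℝ} (hx : x ∈ Set.Ioo (0 : ℝ) 1) :
    HasDerivAt (nielsenDual k b) 0 x := by
  have hx' : 1 - x ∈ Set.Ioo (0 : ℝ) 1 := ⟨by linarith [hx.2], by linarith [hx.1]⟩
  have hx0 : (x : ℂ) ≠ 0 := by exact_mod_cast hx.1.ne'
  have hx1 : (1 - x : ℂ) ≠ 0 := by exact_mod_cast hx'.1.ne'
  have hu : HasDerivAt (fun x : ℝ => -(Real.log x : ℂ)) (-(1 / (x : ℂ))) x := by
    simpa using (Real.hasDerivAt_log hx.1.ne').ofReal_comp.fun_neg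
  have hv : HasDerivAt (fun x : ℝ => -(Real.log (1 - x) : ℂ)) (-(-(1 / (1 - x : ℂ)))) x := by
    have := (((hasDerivAt_id x).const_sub 1).log hx'.1.ne').ofReal_comp.neg
    refine this.congr_deriv ?_
    push_cast
    simp [neg_div]
  have hz : HasDerivAt (fun x : ℝ => (x : ℂ)) (1 / (x : ℂ) * x) x := by
    rw [one_div_mul_cancel hx0]
    exact (hasDerivAt_id x).ofReal_comp
  have hw : HasDerivAt (fun x : ℝ => ((1 - x : ℝ) : ℂ))
      (-(1 / (1 - x : ℂ)) * ((1 - x : ℝ) : ℂ)) x := by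
    refine ((hasDerivAt_id x).const_sub 1).ofReal_comp.congr_deriv ?_
    push_cast
    field_simp
  have hn : ∀ {y : ℝ}, y ∈ Set.Ioo (0 : ℝ) 1 → ‖(y : ℂ)‖ < 1 := fun {y} hy => by
    rw [Complex.norm_real, Real.norm_of_nonneg hy.1.le]; exact hy.2
  have hG := hasDerivAt_nielsenSum k b hu hz (hn hx) hx0
  have hH := hasDerivAt_nielsenSum b k hv hw (hn hx') (by exact_mod_cast hx'.1.ne')
  have hP := ((hu.fun_pow (k + 1)).div_const ((k + 1).factorial : ℂ)).fun_mul
    ((hv.fun_pow (b + 1)).div_const ((b + 1).factorial : ℂ))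
  refine ((hG.fun_add hH).fun_add hP).congr_deriv ?_
  simp only [nielsenLi_one_ofReal b hx, nielsenLi_one_ofReal k hx', sub_sub_cancel]
  have hk : (k.factorial : ℂ) ≠ 0 := by exact_mod_cast k.factorial_ne_zero
  have hb : (b.factorial : ℂ) ≠ 0 := by exact_mod_cast b.factorial_ne_zero
  have hk1 : (k : ℂ) + 1 ≠ 0 := by exact_mod_cast k.succ_ne_zero
  have hb1 : (b : ℂ) + 1 ≠ 0 := by exact_mod_cast b.succ_ne_zero
  simp only [Nat.factorial_succ, Nat.add_sub_cancel]
  push_cast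
  field_simp
  ring

/-- Duality: `ζ(k+2,{1}^b) = ζ(b+2,{1}^k)`. -/
lemma nielsenLi_duality (k b : ℕ) : nielsenLi (2 + k) b 1 = nielsenLi (2 + b) k 1 := by
  have hconst : ∀ x ∈ Set.Ioo (0 : ℝ) 1, nielsenDual k b x = nielsenDual k b (1 / 2) :=
    fun x hx => isOpen_Ioo.is_const_of_deriv_eq_zero isPreconnected_Ioo
      (fun y hy => (hasDerivAt_nielsenDual k b hy).differentiableAt.differentiableWithinAt)
      (fun y hy => (hasDerivAt_nielsenDual k b hy).deriv) hx (by norm_num)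
  have hmem := Ioo_mem_nhdsGT (zero_lt_one (α := ℝ))
  have h1 : nielsenDual k b (1 / 2) = nielsenLi (2 + b) k 1 :=
    tendsto_nhds_unique (tendsto_const_nhds.congr' (by
      filter_upwards [hmem] with x hx using (hconst x hx).symm)) (tendsto_nielsenDual k b)
  have h2 : nielsenDual k b (1 / 2) = nielsenLi (2 + k) b 1 :=
    tendsto_nhds_unique (tendsto_const_nhds.congr' (by
      filter_upwards [hmem] with x hx
      rw [← nielsenDual_symm k b x]
      exact (hconst (1 - x) ⟨by linarith [hx.2], by linarith [hx.1]⟩).symm)) (tendsto_nielsenDual b k)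
  rw [← h1, ← h2]

/-! ### Dominating function and integrability -/

/-- A function all of whose powers are integrable on `[0, 2π]`, used to dominate logarithms. -/
def logSineBound (θ : ℝ) : ℝ := Real.log (2 / Real.sin (θ / 2)) + Real.pi

lemma sin_half_pos {θ : ℝ} (hθ : θ ∈ Set.Ioo 0 (2 * Real.pi)) : 0 < Real.sin (θ / 2) :=
  Real.sin_pos_of_pos_of_lt_pi (by linarith [hθ.1]) (by linarith [hθ.2])

lemma logSineBound_nonneg {θ : ℝ} (hθ : θ ∈ Set.Ioo 0 (2 * Real.pi)) : 0 ≤ logSineBound θ := by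
  have h := sin_half_pos hθ
  refine add_nonneg (Real.log_nonneg ?_) Real.pi_pos.le
  rw [le_div_iff₀ h]
  linarith [Real.sin_le_one (θ / 2)]

/-- The extra π leaves room for the argument of a complex logarithm, so one bound serves both the
real integrand and log(1 - r e^{iθ}). -/
lemma abs_log_add_pi_le_logSineBound {θ x : ℝ} (hθ : θ ∈ Set.Ioo 0 (2 * Real.pi))
    (hx : Real.sin (θ / 2) ≤ x) (hx2 : x ≤ 2) : |Real.log x| + Real.pi ≤ logSineBound θ := by
  have h := sin_half_pos hθ
  have h0 := Real.log_nonpos h.le (Real.sin_le_one _)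
  have h1 := Real.log_le_log h hx
  have h2 := Real.log_le_log (h.trans_le hx) hx2
  have h3 := Real.log_nonneg (one_le_two (α := ℝ))
  rw [logSineBound, Real.log_div two_ne_zero h.ne']
  gcongr
  exact abs_le.2 ⟨by linarith, by linarith⟩

/-- Jordan's inequality handles θ ≤ π; the reflection θ ↦ 2π - θ handles the other half. -/
lemma inv_sin_half_rpow_le {θ : ℝ} (hθ : θ ∈ Set.Ioo 0 (2 * Real.pi)) :
    ((Real.sin (θ / 2))⁻¹) ^ (1 / 2 : ℝ)
      ≤ Real.pi ^ (1 / 2 : ℝ)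
        * (θ ^ (-(1 / 2) : ℝ) + (2 * Real.pi - θ) ^ (-(1 / 2) : ℝ)) := by
  have hpi := Real.pi_pos
  have key : ∀ y : ℝ, 0 < y → y ≤ Real.pi →
      ((Real.sin (y / 2))⁻¹) ^ (1 / 2 : ℝ) ≤ Real.pi ^ (1 / 2 : ℝ) * y ^ (-(1 / 2) : ℝ) := by
    intro y hy hy2
    have h := Real.mul_le_sin (x := y / 2) (by linarith) (by linarith)
    have h' : y / Real.pi ≤ Real.sin (y / 2) := by
      convert h using 1; field_simp
    rw [Real.rpow_neg hy.le, ← Real.inv_rpow hy.le, ← Real.mul_rpow hpi.le (by positivity)]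
    have hpos : 0 < y / Real.pi := by positivity
    refine Real.rpow_le_rpow (inv_nonneg.2 (hpos.le.trans h')) ?_ (by norm_num)
    calc (Real.sin (y / 2))⁻¹ ≤ (y / Real.pi)⁻¹ := inv_anti₀ hpos h'
      _ = Real.pi * y⁻¹ := by rw [inv_div, div_eq_mul_inv]
  have hθ0 : 0 < θ := hθ.1
  have hθ1 : 0 < 2 * Real.pi - θ := by linarith [hθ.2]
  rw [mul_add]
  rcases le_total θ Real.pi with h | h
  · exact (key θ hθ0 h).trans (le_add_of_nonneg_right (by positivity))
  · have := key (2 * Real.pi - θ) hθ1 (by linarith)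
    rw [show (2 * Real.pi - θ) / 2 = Real.pi - θ / 2 by ring, Real.sin_pi_sub] at this
    exact this.trans (le_add_of_nonneg_left (by positivity))

lemma intervalIntegrable_logSineBound_pow (p : ℕ) :
    IntervalIntegrable (fun θ => logSineBound θ ^ p) volume 0 (2 * Real.pi) := by
  have hpi := Real.pi_pos
  -- In log y ≤ y^ε/ε this choice gives ε p ≤ 1/2, also when p = 0. The factor exp π in M below
  -- absorbs the summand π into the logarithm.
  set ε : ℝ := 1 / (2 * (p + 1)) with hε
  have hε0 : 0 < ε := by positivity
  set M : ℝ := 2 * Real.exp Real.pi with hM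
  have hM2 : 2 ≤ M := by nlinarith [Real.one_le_exp hpi.le]
  have hdom : IntervalIntegrable (fun θ : ℝ => M ^ (1 / 2 : ℝ) * (Real.pi ^ (1 / 2 : ℝ)
      * (θ ^ (-(1 / 2) : ℝ) + (2 * Real.pi - θ) ^ (-(1 / 2) : ℝ))) / ε ^ p)
      volume 0 (2 * Real.pi) := by
    have h1 : ∀ a b : ℝ, IntervalIntegrable (fun θ : ℝ => θ ^ (-(1 / 2) : ℝ)) volume a b :=
      fun a b => intervalIntegral.intervalIntegrable_rpow' (by norm_num)
    have h2 : IntervalIntegrable (fun θ : ℝ => (2 * Real.pi - θ) ^ (-(1 / 2) : ℝ)) volume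
        0 (2 * Real.pi) := by
      simpa using (h1 (2 * Real.pi) 0).comp_sub_left (2 * Real.pi)
    exact ((((h1 _ _).add h2).const_mul _).const_mul _).div_const _
  refine hdom.mono_fun' ?_ ?_
  · refine Measurable.aestronglyMeasurable ?_
    unfold logSineBound
    fun_prop
  · rw [Set.uIoc_of_le (by positivity)]
    have hne : ∀ᵐ θ ∂(volume.restrict (Set.Ioc 0 (2 * Real.pi))), θ ≠ 2 * Real.pi :=
      ae_restrict_of_ae (compl_mem_ae_iff.2 (measure_singleton _))
    filter_upwards [hne, ae_restrict_mem measurableSet_Ioc] with θ h1 h2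
    have hθ : θ ∈ Set.Ioo 0 (2 * Real.pi) := ⟨h2.1, lt_of_le_of_ne h2.2 h1⟩
    have hs := sin_half_pos hθ
    have hs1 := Real.sin_le_one (θ / 2)
    have hMs : 1 ≤ M / Real.sin (θ / 2) := by rw [le_div_iff₀ hs]; linarith
    have hlog : logSineBound θ ≤ (M / Real.sin (θ / 2)) ^ ε / ε := by
      refine le_trans (le_of_eq ?_) (Real.log_le_rpow_div (by positivity) hε0)
      rw [logSineBound, hM, mul_div_right_comm, Real.log_mul (by positivity) (by positivity),
        Real.log_exp]
    rw [Real.norm_of_nonneg (pow_nonneg (logSineBound_nonneg hθ) _)]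
    calc logSineBound θ ^ p ≤ ((M / Real.sin (θ / 2)) ^ ε / ε) ^ p :=
          pow_le_pow_left₀ (logSineBound_nonneg hθ) hlog _
      _ = (M / Real.sin (θ / 2)) ^ (ε * p) / ε ^ p := by
          rw [div_pow, ← Real.rpow_natCast _ p, ← Real.rpow_mul (by positivity)]
      _ ≤ (M / Real.sin (θ / 2)) ^ (1 / 2 : ℝ) / ε ^ p := by
          gcongr
          rw [hε, div_mul_eq_mul_div, one_mul, div_le_div_iff₀ (by positivity) (by norm_num)]
          linarith
      _ ≤ _ := by
          rw [div_eq_mul_inv M, Real.mul_rpow (by positivity) (by positivity)]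
          gcongr
          exact inv_sin_half_rpow_le hθ

lemma ae_mem_Ioo_of_mem_uIoc {τ : ℝ} (h0 : 0 ≤ τ) (h1 : τ ≤ 2 * Real.pi) :
    ∀ᵐ θ, θ ∈ Set.uIoc 0 τ → θ ∈ Set.Ioo 0 (2 * Real.pi) := by
  have hne : ∀ᵐ θ : ℝ, θ ≠ 2 * Real.pi := compl_mem_ae_iff.2 (measure_singleton _)
  filter_upwards [hne] with θ h hθ
  rw [Set.uIoc_of_le h0] at hθ
  exact ⟨hθ.1, lt_of_le_of_ne (hθ.2.trans h1) h⟩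

lemma intervalIntegrable_logSineBound_pow_of_le (p : ℕ) {τ : ℝ} (h0 : 0 ≤ τ)
    (h1 : τ ≤ 2 * Real.pi) :
    IntervalIntegrable (fun θ => logSineBound θ ^ p) volume 0 τ :=
  (intervalIntegrable_logSineBound_pow p).mono_set (by
    rw [Set.uIcc_of_le h0, Set.uIcc_of_le (h0.trans h1)]
    exact Set.Icc_subset_Icc_right h1)

lemma intervalIntegrable_logSineIntegrand (n k : ℕ) {τ : ℝ} (h0 : 0 ≤ τ)
    (h1 : τ ≤ 2 * Real.pi) :
    IntervalIntegrable (logSineIntegrand n k) volume 0 τ := by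
  refine ((intervalIntegrable_logSineBound_pow_of_le (n - 1 - k) h0 h1).const_mul
    ((2 * Real.pi) ^ k)).mono_fun' ?_ ?_
  · refine Measurable.aestronglyMeasurable ?_
    unfold logSineIntegrand
    fun_prop
  · rw [Filter.EventuallyLE, ae_restrict_iff' measurableSet_uIoc]
    filter_upwards [ae_mem_Ioo_of_mem_uIoc h0 h1] with θ h hθ
    have hm := h hθ
    have hs := sin_half_pos hm
    rw [logSineIntegrand, norm_mul, norm_pow, norm_pow, Real.norm_of_nonneg hm.1.le,
      Real.norm_eq_abs]
    have := abs_log_add_pi_le_logSineBound hm (x := |2 * Real.sin (θ / 2)|)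
      (by rw [abs_of_pos (by positivity)]; linarith)
      (by rw [abs_of_pos (by positivity)]; linarith [Real.sin_le_one (θ / 2)])
    have hpi := Real.pi_pos
    gcongr
    · exact hm.1.le
    · exact hm.2.le
    · linarith

/-! ### Integration along circles, radial limit and the identity (a) -/

lemma nielsenSum_sub_eq_integral (k b : ℕ) {r : ℝ} (hr0 : 0 < r) (hr1 : r < 1) (τ : ℝ) :
    ∫ t in (0 : ℝ)..τ, Complex.I * ((-Complex.I * t) ^ k / (k.factorial : ℂ))
        * nielsenLi 1 b (r * Complex.exp (Complex.I * t))
      = nielsenSum k b (-Complex.I * τ) (r * Complex.exp (Complex.I * τ))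
        - nielsenLi (2 + k) b r := by
  have hnorm : ∀ t : ℝ, ‖(r : ℂ) * Complex.exp (Complex.I * t)‖ < 1 := by
    intro t
    rw [norm_mul, mul_comm Complex.I, Complex.norm_exp_ofReal_mul_I, mul_one, Complex.norm_real,
      Real.norm_of_nonneg hr0.le]
    exact hr1
  have hu : ∀ t : ℝ, HasDerivAt (fun t : ℝ => -Complex.I * (t : ℂ)) (-Complex.I) t := by
    intro t
    simpa using ((hasDerivAt_id t).ofReal_comp).const_mul (-Complex.I)
  have hz : ∀ t : ℝ, HasDerivAt (fun t : ℝ => (r : ℂ) * Complex.exp (Complex.I * t))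
      (Complex.I * (r * Complex.exp (Complex.I * t))) t := by
    intro t
    have h : HasDerivAt (fun t : ℝ => Complex.I * (t : ℂ)) Complex.I t := by
      simpa using ((hasDerivAt_id t).ofReal_comp).const_mul Complex.I
    refine (h.cexp.const_mul (r : ℂ)).congr_deriv ?_
    ring
  have hd : ∀ t : ℝ, HasDerivAt
      (fun t : ℝ => nielsenSum k b (-Complex.I * t) (r * Complex.exp (Complex.I * t)))
      (Complex.I * ((-Complex.I * t) ^ k / (k.factorial : ℂ))
        * nielsenLi 1 b (r * Complex.exp (Complex.I * t))) t := fun t =>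
    hasDerivAt_nielsenSum k b (hu t) (hz t) (hnorm t)
      (mul_ne_zero (by exact_mod_cast hr0.ne') (Complex.exp_ne_zero _))
  rw [intervalIntegral.integral_eq_sub_of_hasDerivAt (fun t _ => hd t)]
  · simp [nielsenSum_zero_left]
  · refine Continuous.intervalIntegrable ?_ _ _
    have hL : Continuous fun t : ℝ => nielsenLi 1 b (r * Complex.exp (Complex.I * t)) :=
      continuous_iff_continuousAt.2 fun t =>
        ContinuousAt.comp (f := fun t : ℝ => (r : ℂ) * Complex.exp (Complex.I * t))
          (hasDerivAt_nielsenLi_tsum 1 b (hnorm t)).continuousAt (hz t).continuousAt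
    fun_prop

/-- The squared norm is (1-r)² + 4r sin²(θ/2); the lower bound on r makes the estimate uniform as r
→ 1. -/
lemma sin_half_le_norm_one_sub {r θ : ℝ} (hr : 1 / 2 ≤ r) :
    Real.sin (θ / 2) ≤ ‖1 - (r : ℂ) * Complex.exp (Complex.I * θ)‖ := by
  refine (le_abs_self _).trans (abs_le_of_sq_le_sq ?_ (norm_nonneg _))
  rw [Complex.sq_norm, Complex.normSq_apply, mul_comm Complex.I, Complex.exp_mul_I,
    ← Complex.ofReal_cos, ← Complex.ofReal_sin]
  simp only [Complex.sub_re, Complex.one_re, Complex.mul_re, Complex.add_re, Complex.add_im,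
    Complex.ofReal_re, Complex.ofReal_im, Complex.mul_im, Complex.sub_im, Complex.one_im,
    Complex.I_re, Complex.I_im]
  have hc : Real.cos θ = 1 - 2 * Real.sin (θ / 2) ^ 2 := by
    have h1 := Real.cos_two_mul (θ / 2)
    have h2 := Real.sin_sq_add_cos_sq (θ / 2)
    rw [show 2 * (θ / 2) = θ by ring] at h1
    linarith
  have h3 := Real.sin_sq_add_cos_sq θ
  have h4 : (1 - r * Real.cos θ) ^ 2 + (r * Real.sin θ) ^ 2
      = (1 - r) ^ 2 + 4 * r * Real.sin (θ / 2) ^ 2 := by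
    have : (1 - r * Real.cos θ) ^ 2 + (r * Real.sin θ) ^ 2
      = 1 - 2 * r * Real.cos θ + r ^ 2 * (Real.sin θ ^ 2 + Real.cos θ ^ 2) := by ring
    rw [this, h3, hc]; ring
  nlinarith [sq_nonneg (1 - r), sq_nonneg (Real.sin (θ / 2))]

lemma norm_log_one_sub_le {r θ : ℝ} (hr : 1 / 2 ≤ r) (hr1 : r ≤ 1)
    (hθ : θ ∈ Set.Ioo 0 (2 * Real.pi)) :
    ‖Complex.log (1 - (r : ℂ) * Complex.exp (Complex.I * θ))‖ ≤ logSineBound θ := by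
  have h2 : ‖1 - (r : ℂ) * Complex.exp (Complex.I * θ)‖ ≤ 2 := by
    refine (norm_sub_le _ _).trans ?_
    rw [norm_mul, mul_comm Complex.I, Complex.norm_exp_ofReal_mul_I, mul_one, Complex.norm_real,
      Real.norm_of_nonneg (by linarith), norm_one]
    linarith
  refine (Complex.norm_le_abs_re_add_abs_im _).trans ?_
  rw [Complex.log_re, Complex.log_im]
  exact (add_le_add_right (Complex.abs_arg_le_pi _) _).trans
    (abs_log_add_pi_le_logSineBound hθ (sin_half_le_norm_one_sub hr) h2)

lemma one_sub_exp_I_mul (θ : ℝ) :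
    1 - Complex.exp (Complex.I * θ) = ((2 * Real.sin (θ / 2) : ℝ) : ℂ)
      * Complex.exp ((((θ - Real.pi) / 2 : ℝ) : ℂ) * Complex.I) := by
  obtain ⟨y, rfl⟩ : ∃ y, θ = 2 * y := ⟨θ / 2, by ring⟩
  rw [mul_comm Complex.I, Complex.exp_mul_I, Complex.exp_mul_I, ← Complex.ofReal_cos,
    ← Complex.ofReal_sin, ← Complex.ofReal_cos, ← Complex.ofReal_sin,
    show (2 * y - Real.pi) / 2 = y - Real.pi / 2 by ring, Real.cos_sub_pi_div_two,
    Real.sin_sub_pi_div_two, mul_div_cancel_left₀ _ (two_ne_zero' ℝ), Real.sin_two_mul,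
    Real.cos_two_mul']
  push_cast
  linear_combination -Complex.sin_sq_add_cos_sq (y : ℂ)

/-- On this interval 2 sin(θ/2) > 0 and (θ-π)/2 lies in (-π/2, π/2), so the polar form gives the
principal branch. -/
lemma log_one_sub_exp {θ : ℝ} (hθ : θ ∈ Set.Ioo 0 (2 * Real.pi)) :
    Complex.log (1 - Complex.exp (Complex.I * θ))
      = (Real.log |2 * Real.sin (θ / 2)| : ℂ) + Complex.I / 2 * (θ + -Real.pi) := by
  have hs := sin_half_pos hθ
  have hpi := Real.pi_pos
  rw [one_sub_exp_I_mul, Complex.log_ofReal_mul (by positivity) (Complex.exp_ne_zero _),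
    Complex.log_exp, abs_of_pos (by positivity)]
  · push_cast; ring
  · simp; linarith [hθ.1]
  · simp; linarith [hθ.2]

lemma one_sub_exp_mem_slitPlane {θ : ℝ} (hθ : θ ∈ Set.Ioo 0 (2 * Real.pi)) :
    1 - Complex.exp (Complex.I * θ) ∈ Complex.slitPlane := by
  left
  have hs := sin_half_pos hθ
  have hc := Real.cos_two_mul (θ / 2)
  have h2 := Real.sin_sq_add_cos_sq (θ / 2)
  rw [show 2 * (θ / 2) = θ by ring] at hc
  rw [Complex.sub_re, mul_comm, Complex.exp_ofReal_mul_I_re, Complex.one_re]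
  nlinarith

/-- Both sides are limits as r → 1⁻ of the identity on the circle of radius r: the left by
continuity on the closed disc, the right by dominated convergence. -/
lemma nielsenSum_exp_sub_eq_integral (k b : ℕ) {τ : ℝ} (h0 : 0 ≤ τ) (h1 : τ ≤ 2 * Real.pi) :
    nielsenSum k b (-Complex.I * τ) (Complex.exp (Complex.I * τ)) - nielsenLi (2 + k) b 1
      = ∫ t in (0 : ℝ)..τ, Complex.I * ((-Complex.I * t) ^ k / (k.factorial : ℂ))
          * ((-((Real.log |2 * Real.sin (t / 2)| : ℂ) + Complex.I / 2 * (t + -Real.pi))) ^ (b + 1)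
            / ((b + 1).factorial : ℂ)) := by
  have hpi := Real.pi_pos
  have hr : Tendsto (fun r : ℝ => r) (𝓝[<] 1) (𝓝 1) := tendsto_id.mono_left nhdsWithin_le_nhds
  have hrC : Tendsto (fun r : ℝ => (r : ℂ)) (𝓝[<] 1) (𝓝 1) := by simpa using hr.ofReal
  have hmem : ∀ᶠ r : ℝ in 𝓝[<] 1, r ∈ Set.Ioo (1 / 2 : ℝ) 1 := Ioo_mem_nhdsLT (by norm_num)
  have hexp : ∀ t : ℝ, ‖Complex.exp (Complex.I * t)‖ = 1 := fun t => by
    rw [mul_comm, Complex.norm_exp_ofReal_mul_I]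
  have hnorm : ∀ r ∈ Set.Ioo (1 / 2 : ℝ) 1, ∀ t : ℝ,
      ‖(r : ℂ) * Complex.exp (Complex.I * t)‖ < 1 := by
    intro r hr t
    rw [norm_mul, hexp, mul_one, Complex.norm_real, Real.norm_of_nonneg (by linarith [hr.1])]
    exact hr.2
  have hlhs : Tendsto (fun r : ℝ =>
      nielsenSum k b (-Complex.I * τ) (r * Complex.exp (Complex.I * τ)) - nielsenLi (2 + k) b r)
      (𝓝[<] 1) (𝓝 (nielsenSum k b (-Complex.I * τ) (Complex.exp (Complex.I * τ))
        - nielsenLi (2 + k) b 1)) := by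
    refine Tendsto.sub (tendsto_nielsenSum k b tendsto_const_nhds ?_ (hexp τ).le ?_) ?_
    · simpa using hrC.mul_const (Complex.exp (Complex.I * τ))
    · exact hmem.mono fun r hr => (hnorm r hr τ).le
    · simp only [← nielsenSum_zero_left]
      refine tendsto_nielsenSum k b tendsto_const_nhds hrC (by simp) ?_
      refine hmem.mono fun r hr => ?_
      simpa using (hnorm r hr 0).le
  refine tendsto_nhds_unique hlhs ?_
  have hint : Tendsto (fun r : ℝ => ∫ t in (0 : ℝ)..τ,
      Complex.I * ((-Complex.I * t) ^ k / (k.factorial : ℂ))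
        * ((-Complex.log (1 - r * Complex.exp (Complex.I * t))) ^ (b + 1)
          / ((b + 1).factorial : ℂ))) (𝓝[<] 1)
      (𝓝 (∫ t in (0 : ℝ)..τ, Complex.I * ((-Complex.I * t) ^ k / (k.factorial : ℂ))
          * ((-((Real.log |2 * Real.sin (t / 2)| : ℂ) + Complex.I / 2 * (t + -Real.pi))) ^ (b + 1)
            / ((b + 1).factorial : ℂ)))) := by
    refine intervalIntegral.tendsto_integral_filter_of_dominated_convergence
      (fun t => (2 * Real.pi) ^ k / k.factorial * (logSineBound t ^ (b + 1) / (b + 1).factorial))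
      (Eventually.of_forall fun r => ?_) ?_ ?_ ?_
    · refine Measurable.aestronglyMeasurable ?_
      fun_prop
    · filter_upwards [hmem] with r hr
      filter_upwards [ae_mem_Ioo_of_mem_uIoc h0 h1] with t ht htm
      have hm := ht htm
      simp only [norm_mul, norm_div, norm_pow, norm_neg, Complex.norm_I, one_mul,
        Complex.norm_natCast, Complex.norm_real, Real.norm_of_nonneg hm.1.le]
      have hb := norm_log_one_sub_le hr.1.le hr.2.le hm
      have h0' := hm.1.le
      have h2 := hm.2.le
      gcongr
    · exact ((intervalIntegrable_logSineBound_pow_of_le (b + 1) h0 h1).div_const _).const_mul _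
    · filter_upwards [ae_mem_Ioo_of_mem_uIoc h0 h1] with t ht htm
      have hm := ht htm
      rw [← log_one_sub_exp hm]
      refine Tendsto.const_mul _ (Tendsto.div_const (Tendsto.pow (Tendsto.neg ?_) _) _)
      refine Tendsto.clog ?_ (one_sub_exp_mem_slitPlane hm)
      simpa using (hrC.mul_const (Complex.exp (Complex.I * t))).const_sub 1
  refine hint.congr' ?_
  filter_upwards [hmem] with r hr
  rw [← nielsenSum_sub_eq_integral k b (by linarith [hr.1]) hr.2 τ]
  refine intervalIntegral.integral_congr fun t _ => ?_
  simp only [nielsenLi_one b (hnorm r hr t)]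

lemma ofReal_logSine (n k : ℕ) (τ : ℝ) :
    (logSine n k τ : ℂ) = ∫ t in (0 : ℝ)..τ, -(logSineIntegrand n k t : ℂ) := by
  rw [logSine, intervalIntegral.integral_neg, intervalIntegral.integral_ofReal]
  push_cast
  rfl

lemma multinom3_eq {k b r m : ℕ} (hr : r ≤ b + 1) (hm : m ≤ r) :
    (multinom3 (k + 1 + b) k m (r - m) : ℂ)
      = (k + 1 + b).factorial / (k.factorial * (b + 1).factorial)
        * ((r.choose m : ℂ) * ((b + 1).choose r : ℂ)) := by
  rw [multinom3, Nat.cast_choose ℂ hr, Nat.cast_choose ℂ hm,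
    show k + 1 + b - k - m - (r - m) = b + 1 - r by omega]
  have h : ∀ n : ℕ, (n.factorial : ℂ) ≠ 0 := fun n => by exact_mod_cast n.factorial_ne_zero
  have := h k
  have := h (b + 1)
  have := h r
  have := h m
  have := h (r - m)
  have := h (b + 1 - r)
  push_cast
  field_simp

/-- Binomial expansion of (log + (i/2)(t-π))^(b+1) in r, then of (t-π)^r in m; the log power left is
b+1-r. The leading minus sign matches the one in the definition of `logSine`. -/
lemma integrand_expansion (k b : ℕ) (t : ℝ) :
    -(Complex.I * ((-Complex.I * t) ^ k / (k.factorial : ℂ))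
          * ((-((Real.log |2 * Real.sin (t / 2)| : ℂ) + Complex.I / 2 * (t + -Real.pi))) ^ (b + 1)
            / ((b + 1).factorial : ℂ)))
      = Complex.I ^ (k + 1) * (-1) ^ (k + 1 + b) / ((k + 1 + b).factorial : ℂ)
          * ∑ r ∈ Finset.range (b + 2), ∑ m ∈ Finset.range (r + 1),
              (multinom3 (k + 1 + b) k m (r - m) : ℂ) * (Complex.I / 2) ^ r
                * (-(Real.pi : ℂ)) ^ (r - m)
                * -(logSineIntegrand (k + 2 + b - (r - m)) (k + m) t : ℂ) := by
  have hN : ((k + 1 + b).factorial : ℂ) ≠ 0 := by exact_mod_cast (k + 1 + b).factorial_ne_zero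
  have hsum : ∑ r ∈ Finset.range (b + 2), ∑ m ∈ Finset.range (r + 1),
              (multinom3 (k + 1 + b) k m (r - m) : ℂ) * (Complex.I / 2) ^ r
                * (-(Real.pi : ℂ)) ^ (r - m)
                * -(logSineIntegrand (k + 2 + b - (r - m)) (k + m) t : ℂ)
      = -((k + 1 + b).factorial / (k.factorial * (b + 1).factorial) * (t : ℂ) ^ k)
        * ((Real.log |2 * Real.sin (t / 2)| : ℂ) + Complex.I / 2 * (t + -Real.pi)) ^ (b + 1) := by
    rw [add_comm (Real.log |2 * Real.sin (t / 2)| : ℂ), add_pow, Finset.mul_sum]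
    refine Finset.sum_congr rfl fun r hr => ?_
    have hr' : r ≤ b + 1 := by have := Finset.mem_range.1 hr; omega
    rw [mul_pow, add_pow (t : ℂ), Finset.mul_sum, Finset.sum_mul, Finset.sum_mul, Finset.mul_sum]
    refine Finset.sum_congr rfl fun m hm => ?_
    have hm' : m ≤ r := by have := Finset.mem_range.1 hm; omega
    rw [multinom3_eq hr' hm', logSineIntegrand,
      show k + 2 + b - (r - m) - 1 - (k + m) = b + 1 - r by omega]
    push_cast
    ring
  rw [hsum, neg_pow (_ + _), mul_pow, neg_pow Complex.I k]
  field_simp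
  ring

lemma nielsen_logSine_identity (n k : ℕ) {τ : ℝ} (hn : k + 2 ≤ n) (h0 : 0 ≤ τ)
    (h1 : τ ≤ 2 * Real.pi) :
    multiZeta (nielsenIndex (n - k) k)
        - ∑ j ∈ Finset.range (k + 1), (-Complex.I * (τ : ℂ)) ^ j / (j.factorial : ℂ)
            * multiPolylog (nielsenIndex (2 + k - j) (n - k - 2))
                (Complex.exp (Complex.I * (τ : ℂ)))
      = Complex.I ^ (k + 1) * (-1) ^ (n - 1) / ((n - 1).factorial : ℂ)
        * ∑ r ∈ Finset.range (n - k), ∑ m ∈ Finset.range (r + 1),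
            (multinom3 (n - 1) k m (r - m) : ℂ) * (Complex.I / 2) ^ r
              * (-(Real.pi : ℂ)) ^ (r - m)
              * (logSine (n - (r - m)) (k + m) τ : ℂ) := by
  obtain ⟨b, rfl⟩ := Nat.exists_eq_add_of_le hn
  have hexp : ‖Complex.exp (Complex.I * τ)‖ ≤ 1 := by
    rw [mul_comm, Complex.norm_exp_ofReal_mul_I]
  rw [show k + 2 + b - k - 2 = b by omega, show k + 2 + b - 1 = k + 1 + b by omega,
    show k + 2 + b - k = b + 2 by omega, multiZeta,
    -- The integral produces ζ(2+k,{1}^b), so the stated ζ(2+b,{1}^k) is dualized.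
    multiPolylog_nielsenIndex (by omega) k (by simp), add_comm b 2, ← nielsenLi_duality]
  have hS : ∑ j ∈ Finset.range (k + 1), (-Complex.I * (τ : ℂ)) ^ j / (j.factorial : ℂ)
      * multiPolylog (nielsenIndex (2 + k - j) b) (Complex.exp (Complex.I * (τ : ℂ)))
      = nielsenSum k b (-Complex.I * τ) (Complex.exp (Complex.I * τ)) := by
    refine Finset.sum_congr rfl fun j hj => ?_
    rw [multiPolylog_nielsenIndex (by have := Finset.mem_range.1 hj; omega) b hexp]
  rw [hS, ← neg_sub, nielsenSum_exp_sub_eq_integral k b h0 h1, ← intervalIntegral.integral_neg]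
  simp only [integrand_expansion, ofReal_logSine]
  have hint : ∀ (c : ℂ) (n k : ℕ), IntervalIntegrable
      (fun t => c * -(logSineIntegrand n k t : ℂ)) volume 0 τ := by
    intro c n k
    have h := intervalIntegrable_logSineIntegrand n k h0 h1
    have h' : IntervalIntegrable (fun t => (logSineIntegrand n k t : ℂ)) volume 0 τ :=
      ⟨Integrable.ofReal h.1, Integrable.ofReal h.2⟩
    exact h'.neg.const_mul c
  rw [intervalIntegral.integral_const_mul, add_comm 2 b, intervalIntegral.integral_finsetSum]
  · congr 1
    refine Finset.sum_congr rfl fun r _ => ?_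
    rw [intervalIntegral.integral_finsetSum fun m _ => hint _ _ _]
    exact Finset.sum_congr rfl fun m _ => intervalIntegral.integral_const_mul _ _
  · intro r _
    have := IntervalIntegrable.sum (Finset.range (r + 1)) (fun m _ => hint
      ((multinom3 (k + 1 + b) k m (r - m) : ℂ) * (Complex.I / 2) ^ r * (-(Real.pi : ℂ)) ^ (r - m))
      (k + 2 + b - (r - m)) (k + m))
    simpa [Finset.sum_fn] using this

/-! ### Log-sine integrals as rational polynomials in the generators -/

/-- The complex functions whose real and imaginary parts lie in `A`. -/
def reImSubalgebra {X : Type*} (A : Subalgebra ℚ (X → ℝ)) : Subalgebra ℚ (X → ℂ) where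
  carrier := {f | (fun x => (f x).re) ∈ A ∧ (fun x => (f x).im) ∈ A}
  mul_mem' {f g} hf hg := by
    constructor
    · exact A.sub_mem (A.mul_mem hf.1 hg.1) (A.mul_mem hf.2 hg.2)
    · exact A.add_mem (A.mul_mem hf.1 hg.2) (A.mul_mem hf.2 hg.1)
  add_mem' {f g} hf hg := ⟨A.add_mem hf.1 hg.1, A.add_mem hf.2 hg.2⟩
  algebraMap_mem' q := by
    constructor
    · convert A.algebraMap_mem q using 1
      funext x
      simp [Pi.algebraMap_apply]
    · convert A.zero_mem using 1
      funext x
      simp [Pi.algebraMap_apply]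

section

variable {X : Type*} {A : Subalgebra ℚ (X → ℝ)}

lemma ofReal_mem_reImSubalgebra {f : X → ℝ} (hf : f ∈ A) :
    (fun x => (f x : ℂ)) ∈ reImSubalgebra A :=
  ⟨by simpa using hf, A.zero_mem⟩

lemma I_mem_reImSubalgebra : (fun _ => Complex.I) ∈ reImSubalgebra A :=
  ⟨A.zero_mem, A.one_mem⟩

lemma ratCast_mem (B : Subalgebra ℚ (X → ℂ)) (q : ℚ) : (fun _ => (q : ℂ)) ∈ B :=
  B.algebraMap_mem q

lemma mul_fun_mem (B : Subalgebra ℚ (X → ℂ)) {f g : X → ℂ} (hf : f ∈ B) (hg : g ∈ B) :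
    (fun x => f x * g x) ∈ B := B.mul_mem hf hg

lemma sub_fun_mem (B : Subalgebra ℚ (X → ℂ)) {f g : X → ℂ} (hf : f ∈ B) (hg : g ∈ B) :
    (fun x => f x - g x) ∈ B := B.sub_mem hf hg

lemma pow_fun_mem (B : Subalgebra ℚ (X → ℂ)) {f : X → ℂ} (hf : f ∈ B) (n : ℕ) :
    (fun x => f x ^ n) ∈ B := B.pow_mem hf n

lemma neg_fun_mem (B : Subalgebra ℚ (X → ℂ)) {f : X → ℂ} (hf : f ∈ B) :
    (fun x => -f x) ∈ B := B.neg_mem hf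

lemma div_natCast_mem (B : Subalgebra ℚ (X → ℂ)) {f : X → ℂ} (hf : f ∈ B) (n : ℕ) :
    (fun x => f x / (n : ℂ)) ∈ B := by
  have := mul_fun_mem B hf (ratCast_mem B ((n : ℚ)⁻¹))
  simpa [div_eq_mul_inv] using this

lemma sum_fun_mem (B : Subalgebra ℚ (X → ℂ)) {ι : Type*} {s : Finset ι} {f : ι → X → ℂ}
    (hf : ∀ i ∈ s, f i ∈ B) : (fun x => ∑ i ∈ s, f i x) ∈ B := by
  have := B.sum_mem hf
  rwa [Finset.sum_fn] at this

end

/-- The polynomials with rational coefficients in the generators. -/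
abbrev logSineAlgebra : Subalgebra ℚ (Set.Icc (0 : ℝ) (2 * Real.pi) → ℝ) :=
  Algebra.adjoin ℚ {f | IsLogSineGenerator f}

/-- Only real parts of zeta values are generators; nothing is lost because the series has real
terms. -/
lemma multiZeta_ofReal_re {s : ℕ} (hs : 2 ≤ s) (b : ℕ) :
    ((multiZeta (nielsenIndex s b)).re : ℂ) = multiZeta (nielsenIndex s b) := by
  have h : multiZeta (nielsenIndex s b)
      = ((∑' n : ℕ, nielsenCoeff b n / (n : ℝ) ^ s : ℝ) : ℂ) := by
    rw [multiZeta, multiPolylog_nielsenIndex hs b (by simp), nielsenLi, Complex.ofReal_tsum]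
    simp
  rw [h, Complex.ofReal_re]

lemma multiZeta_mem {s : ℕ} (hs : 2 ≤ s) (b : ℕ) :
    (fun _ => multiZeta (nielsenIndex s b)) ∈ reImSubalgebra logSineAlgebra := by
  have := ofReal_mem_reImSubalgebra (A := logSineAlgebra)
    (Algebra.subset_adjoin (IsLogSineGenerator.zeta s b hs))
  simpa only [multiZeta_ofReal_re hs] using this

/-- The parity of the weight only decides which part is called Clausen and which Glaisher; both are
generators. -/
lemma multiPolylog_mem {s : ℕ} (hs : 2 ≤ s) (b : ℕ) :
    (fun τ : Set.Icc (0 : ℝ) (2 * Real.pi) =>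
      multiPolylog (nielsenIndex s b) (Complex.exp (Complex.I * ((τ : ℝ) : ℂ))))
      ∈ reImSubalgebra logSineAlgebra := by
  have hc : _ ∈ logSineAlgebra := Algebra.subset_adjoin (IsLogSineGenerator.clausen s b hs)
  have hg : _ ∈ logSineAlgebra := Algebra.subset_adjoin (IsLogSineGenerator.glaisher s b hs)
  by_cases h : Even (∑ i, nielsenIndex s b i)
  · simp only [multiClausen, multiGlaisher, if_pos h] at hc hg
    exact ⟨hg, hc⟩
  · simp only [multiClausen, multiGlaisher, if_neg h] at hc hg
    exact ⟨hc, hg⟩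

lemma arg_mem : (fun τ : Set.Icc (0 : ℝ) (2 * Real.pi) => (((τ : ℝ) : ℂ)))
    ∈ reImSubalgebra logSineAlgebra :=
  ofReal_mem_reImSubalgebra (Algebra.subset_adjoin IsLogSineGenerator.arg)

lemma pi_mem : (fun _ => (Real.pi : ℂ)) ∈ reImSubalgebra logSineAlgebra :=
  ofReal_mem_reImSubalgebra (Algebra.subset_adjoin IsLogSineGenerator.pi)

lemma logSine_succ_self (k : ℕ) (τ : ℝ) : logSine (k + 1) k τ = -(τ ^ (k + 1) / (k + 1 : ℕ)) := by
  simp [logSine, logSineIntegrand, integral_pow]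

/-- Strong induction on the log exponent N = n-1-k. It is uniform in k, because the identity raises
k to k+m while lowering N. -/
lemma ofReal_logSine_mem (N : ℕ) : ∀ k : ℕ,
    (fun τ : Set.Icc (0 : ℝ) (2 * Real.pi) => (logSine (k + 1 + N) k τ : ℂ))
      ∈ reImSubalgebra logSineAlgebra := by
  set B := reImSubalgebra logSineAlgebra with hB
  induction N using Nat.strong_induction_on with
  | _ N ih =>
  intro k
  rcases N with _ | b
  · have h := neg_fun_mem B (div_natCast_mem B (pow_fun_mem B arg_mem (k + 1)) (k + 1))
    convert h using 2 with τ
    rw [add_zero, logSine_succ_self]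
    push_cast
    rfl
  set n := k + 1 + (b + 1) with hn
  have hI : (fun _ => Complex.I) ∈ B := I_mem_reImSubalgebra
  have hone : (fun _ => (1 : ℂ)) ∈ B := B.one_mem
  set lhs : Set.Icc (0 : ℝ) (2 * Real.pi) → ℂ := fun τ => multiZeta (nielsenIndex (n - k) k)
        - ∑ j ∈ Finset.range (k + 1), (-Complex.I * ((τ : ℝ) : ℂ)) ^ j / (j.factorial : ℂ)
            * multiPolylog (nielsenIndex (2 + k - j) (n - k - 2))
                (Complex.exp (Complex.I * ((τ : ℝ) : ℂ))) with hlhs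
  have hlhs_mem : lhs ∈ B := by
    refine sub_fun_mem B (multiZeta_mem (by omega) k) (sum_fun_mem B fun j hj => ?_)
    refine mul_fun_mem B (div_natCast_mem B (pow_fun_mem B
      (mul_fun_mem B (neg_fun_mem B hI) arg_mem) j) _) (multiPolylog_mem ?_ _)
    have := Finset.mem_range.1 hj
    omega
  -- The terms of index r+1 ≥ 1: their log exponent is b-r, below b+1, so induction applies.
  set rest : Set.Icc (0 : ℝ) (2 * Real.pi) → ℂ := fun τ =>
    ∑ r ∈ Finset.range (b + 1), ∑ m ∈ Finset.range (r + 1 + 1),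
            (multinom3 (n - 1) k m (r + 1 - m) : ℂ) * (Complex.I / (2 : ℕ)) ^ (r + 1)
              * (-(Real.pi : ℂ)) ^ (r + 1 - m)
              * (logSine (n - (r + 1 - m)) (k + m) τ : ℂ) with hrest
  have hrest_mem : rest ∈ B := by
    refine sum_fun_mem B fun r hr => sum_fun_mem B fun m hm => ?_
    have hr' := Finset.mem_range.1 hr
    have hm' := Finset.mem_range.1 hm
    have hlog := ih (b - r) (by omega) (k + m)
    rw [show k + m + 1 + (b - r) = n - (r + 1 - m) by omega] at hlog
    exact mul_fun_mem B (mul_fun_mem B (mul_fun_mem B (ratCast_mem B _)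
      (pow_fun_mem B (div_natCast_mem B hI 2) _)) (pow_fun_mem B (neg_fun_mem B pi_mem) _)) hlog
  have hmult : multinom3 (n - 1) k 0 (0 - 0) ≠ 0 := by
    have h : ∀ i : ℕ, (i.factorial : ℚ) ≠ 0 := fun i => by exact_mod_cast i.factorial_ne_zero
    exact div_ne_zero (h _) (mul_ne_zero (mul_ne_zero (mul_ne_zero (h _) (h _)) (h _)) (h _))
  -- The identity solved for its r = 0 term; (-i)^(k+1) inverts i^(k+1), so the coefficients stay in
  -- ℚ(i).
  have hmem : (fun τ => ((multinom3 (n - 1) k 0 (0 - 0))⁻¹ : ℚ)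
      * (((((n - 1).factorial : ℚ) : ℂ) * (-Complex.I) ^ (k + 1) * (-1) ^ (n - 1)) * lhs τ
        - rest τ)) ∈ B :=
    mul_fun_mem B (ratCast_mem B _) (sub_fun_mem B (mul_fun_mem B (mul_fun_mem B
      (mul_fun_mem B (ratCast_mem B _) (pow_fun_mem B (neg_fun_mem B hI) _))
      (pow_fun_mem B (neg_fun_mem B hone) _)) hlhs_mem) hrest_mem)
  convert hmem using 2 with τ
  have hl : lhs τ = _ := nielsen_logSine_identity n k (by omega) τ.2.1 τ.2.2
  rw [show n - k = b + 1 + 1 by omega, Finset.sum_range_succ' _ (b + 1), zero_add,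
    Finset.sum_range_one] at hl
  have hfac : ((n - 1).factorial : ℂ) ≠ 0 := by exact_mod_cast (n - 1).factorial_ne_zero
  have hII : (-Complex.I) ^ (k + 1) * Complex.I ^ (k + 1) = 1 := by
    rw [← mul_pow]; simp
  have hpm : ((-1 : ℂ)) ^ (n - 1) * (-1) ^ (n - 1) = 1 := by
    rw [← mul_pow]; simp
  have hmult' : (multinom3 (n - 1) k 0 (0 - 0) : ℂ) ≠ 0 := by exact_mod_cast hmult
  rw [hl]
  have hcancel : ∀ S : ℂ, ((((n - 1).factorial : ℚ) : ℂ) * (-Complex.I) ^ (k + 1)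
      * (-1) ^ (n - 1)) * (Complex.I ^ (k + 1) * (-1) ^ (n - 1) / ((n - 1).factorial : ℂ) * S)
      = S := by
    intro S
    calc _ = ((-Complex.I) ^ (k + 1) * Complex.I ^ (k + 1))
          * ((-1 : ℂ) ^ (n - 1) * (-1) ^ (n - 1)) * S := by
          push_cast
          field_simp
      _ = S := by rw [hII, hpm]; ring
  rw [hcancel]
  simp only [hrest, Nat.cast_ofNat, add_sub_cancel_left, pow_zero, mul_one, add_zero,
    Nat.sub_zero, Rat.cast_inv] at hmult' ⊢
  rw [inv_mul_cancel_left₀ hmult']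

end

theorem theorem4 :
    -- the series and integrals involved converge (absolutely)
    (∀ (s b : ℕ) (z : ℂ), 2 ≤ s → ‖z‖ ≤ 1 →
      Summable (multiPolylogTerm (nielsenIndex s b) z)) ∧
    (∀ (n k : ℕ) (τ : ℝ), k + 1 ≤ n → 0 ≤ τ → τ ≤ 2 * Real.pi →
      IntervalIntegrable (logSineIntegrand n k) MeasureTheory.volume 0 τ) ∧
    -- the identity
    (∀ (n k : ℕ) (τ : ℝ), k + 2 ≤ n → 0 ≤ τ → τ ≤ 2 * Real.pi →
      multiZeta (nielsenIndex (n - k) k)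
          - ∑ j ∈ Finset.range (k + 1), (-Complex.I * (τ : ℂ)) ^ j / (j.factorial : ℂ)
              * multiPolylog (nielsenIndex (2 + k - j) (n - k - 2))
                  (Complex.exp (Complex.I * (τ : ℂ)))
        = Complex.I ^ (k + 1) * (-1) ^ (n - 1) / ((n - 1).factorial : ℂ)
          * ∑ r ∈ Finset.range (n - k), ∑ m ∈ Finset.range (r + 1),
              (multinom3 (n - 1) k m (r - m) : ℂ) * (Complex.I / 2) ^ r
                * (-(Real.pi : ℂ)) ^ (r - m)
                * (logSine (n - (r - m)) (k + m) τ : ℂ)) ∧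
    -- every log-sine integral, as a function of `τ ∈ [0, 2π]`, is a polynomial with rational
    -- coefficients in the generators
    (∀ n k : ℕ, k + 1 ≤ n →
      (fun τ : Set.Icc (0 : ℝ) (2 * Real.pi) => logSine n k τ) ∈
        Algebra.adjoin ℚ {f | IsLogSineGenerator f}) := by
  refine ⟨fun s b z hs hz => summable_multiPolylogTerm hs b hz,
    fun n k τ _ h0 h1 => intervalIntegrable_logSineIntegrand n k h0 h1,
    fun n k τ hn h0 h1 => nielsen_logSine_identity n k hn h0 h1, fun n k hn => ?_⟩
  obtain ⟨N, rfl⟩ := Nat.exists_eq_add_of_le hn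
  -- Taking the real part removes i from the coefficients.
  simpa using (ofReal_logSine_mem N k).1
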